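/- Let $G=(X,Y,E)$ be a simple bipartite $d$-regular graph on $n$ vertices, with parts $X$ and $Y$, where $1\le d\le n/4$. Let $\lambda_1\ge\lambda_2\ge\dots\ge\lambda_n$ be the eigenvalues of its adjacency matrix, with multiplicity, and let $\lambda=\max\{\lambda_2,|\lambda_{n-1}|\}$ be the third largest eigenvalue in absolute value. For nonnegative integers $k,t$, let $BGP_{k,t}(G)$ be the bipartite graph with parts $X^k$ and $Y^k$ in which $(x_1,\dots,x_k)\in X^k$ and $(y_1,\dots,y_k)\in Y^k$ are adjacent if and only if at least $t$ of the pairs $(x_i,y_i)$ are edges of $G$. Then $BGP_{k,t}(G)$ is $d_2$-regular, where $$d_2=\sum_{t'=t}^{k}\binom{k}{t'}d^{t'}\Bigl(\frac n2-d\Bigr)^{k-t'},$$ and for any two sets of vertices $S\subseteq X^k$ and $T\subseteq Y^k$, $$\left|e(S,T)-\mu_{S,T}\right|\le\frac{\lambda}{d}\cdot d_2\sqrt{|S||T|}.$$ Here $e(S,T)$ is the number of edges of $BGP_{k,t}(G)$ between $S$ and $T$, and $\mu_{S,T}=\dfrac{d_2|S||T|}{N/2}$, where $N=|X|^k+|Y|^k$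 is the number of vertices of $BGP_{k,t}(G)$. -/

import Mathlib

noncomputable section

namespace BipartiteProduct

/-- The eigenvalues, with multiplicity, of the adjacency matrix of a finite graph on `n` vertices,
listed in decreasing order and numbered from `0`: in the usual notation
`eigenvalue G i` is `λ_{i+1}` for `i < n`, where `λ_1 ≥ λ_2 ≥ … ≥ λ_n`.
(The value is `0` for `i ≥ n`.) -/
def eigenvalue {V : Type*} [Fintype V] [DecidableEq V] (G : SimpleGraph V) [DecidableRel G.Adj]
    (i : ℕ) : ℝ :=
  if h : i < Fintype.card V then
    Matrix.IsHermitian.eigenvalues₀ (A := G.adjMatrix ℝ) (G.isHermitian_adjMatrix (R := ℝ)) ⟨i, h⟩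
  else 0

/-- For a bipartite graph on `n` vertices with adjacency eigenvalues `λ_1 ≥ … ≥ λ_n`, this is
`λ(G) = max {λ_2, |λ_{n-1}|}`, the third largest eigenvalue in absolute value. -/
def bipartiteLambda {V : Type*} [Fintype V] [DecidableEq V] (G : SimpleGraph V)
    [DecidableRel G.Adj] : ℝ :=
  max (eigenvalue G 1) |eigenvalue G (Fintype.card V - 2)|

/-- The bipartite graph product `BGP_{k,t}(G)` of a graph `G` with parts `X` and `Y`: its parts are
`X^k` and `Y^k`, and `x ∈ X^k`, `y ∈ Y^k` are adjacent iff at least `t` of the pairs `(x_i, y_i)`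
are edges of `G`. -/
def bgp {X Y : Type*} (G : SimpleGraph (X ⊕ Y)) [DecidableRel G.Adj] (k t : ℕ) :
    SimpleGraph ((Fin k → X) ⊕ (Fin k → Y)) where
  Adj
    | .inl x, .inr y =>
        t ≤ (Finset.univ.filter fun i : Fin k => G.Adj (.inl (x i)) (.inr (y i))).card
    | .inr y, .inl x =>
        t ≤ (Finset.univ.filter fun i : Fin k => G.Adj (.inl (x i)) (.inr (y i))).card
    | .inl _, .inl _ => False
    | .inr _, .inr _ => False
  symm := ⟨by
    rintro (x | y) (x' | y') h
    · exact h
    · exact h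
    · exact h
    · exact h⟩
  loopless := ⟨by
    rintro (x | y) h
    · exact h
    · exact h⟩

instance bgpDecidableAdj {X Y : Type*} (G : SimpleGraph (X ⊕ Y)) [DecidableRel G.Adj] (k t : ℕ) :
    DecidableRel (bgp G k t).Adj :=
  Classical.decRel _

/-- `d₂ = ∑_{t'=t}^{k} (k choose t') d^{t'} (n/2 - d)^{k-t'}`. -/
def d₂ (n d k t : ℕ) : ℝ :=
  ∑ s ∈ Finset.Icc t k, (k.choose s : ℝ) * (d : ℝ) ^ s * ((n : ℝ) / 2 - (d : ℝ)) ^ (k - s)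

/-- `e(S,T)`: the number of edges between two vertex sets, an edge inside `S ∩ T` counting twice
(the number of pairs `(u, v) ∈ S × T` that are adjacent). -/
def edgeCount {V : Type*} (H : SimpleGraph V) [DecidableRel H.Adj]
    (S T : Finset V) : ℕ :=
  (H.interedges S T).card

/-- `μ_{S,T} = D |S| |T| / (N/2)`, the expected number of edges between `S` and `T`, one in each
part, in a `D`-regular bipartite graph on the `N`-element vertex set `V`. -/
def mu (V : Type*) [Fintype V] (D : ℝ) (S T : Finset V) : ℝ :=
  D * (S.card : ℝ) * (T.card : ℝ) / ((Fintype.card V : ℝ) / 2)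

end BipartiteProduct

end

/-!
Let `B` be the biadjacency matrix of `G` and `J` the all-ones matrix. On functions of sum zero `B`
has norm at most `λ`, and `J - B` acts there as `-B`. Call a nonnegative matrix with all row and
column sums `r` mixing with ratio `θ` if its norm on functions of sum zero is at most `θ * r`. Then
`B` is mixing with ratio `λ / d`, and so is `J - B`, whose degree `n / 2 - d` is at least `d`.

For a fixed ratio, mixing matrices are closed under sums, by Minkowski's inequality, and under
Kronecker products: a function on pairs splits into its slice means and its slices of mean zero, two
parts that stay orthogonal under the product, one factor contracting the first part and the other
the second. The biadjacency matrix of `BGP_{k,t}(G)` is the sum, over the sets `I` of at least `t`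
coordinates, of the Kronecker products of `B` for `i ∈ I` and `J - B` for `i ∉ I`; the degrees add
up to `d₂`, and the expander mixing lemma applies.
-/

namespace BipartiteProduct

open Finset Matrix
open scoped BigOperators Kronecker InnerProductSpace

section SumSq

variable {ι : Type*} [Fintype ι]

theorem sum_sq_add_const {f : ι → ℝ} (hf : ∑ i, f i = 0) (a : ℝ) :
    ∑ i, (f i + a) ^ 2 = ∑ i, f i ^ 2 + Fintype.card ι * a ^ 2 := by
  simp only [add_sq, sum_add_distrib, ← sum_mul, ← mul_sum, hf, sum_const, card_univ, nsmul_eq_mul,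
    mul_zero, zero_mul, add_zero]

theorem sum_sq_eq_sum_sq_balance_add (f : ι → ℝ) :
    ∑ i, f i ^ 2 = ∑ i, Fintype.balance f i ^ 2 + Fintype.card ι * (𝔼 i, f i) ^ 2 := by
  rw [← sum_sq_add_const (Fintype.sum_balance f)]
  simp only [Fintype.balance_apply, sub_add_cancel]

theorem sum_sq_sum_le {κ : Type*} (s : Finset κ) {f : κ → ι → ℝ} {c : κ → ℝ} {C : ℝ}
    (hC : 0 ≤ C) (hc : ∀ j ∈ s, 0 ≤ c j) (hf : ∀ j ∈ s, ∑ i, f j i ^ 2 ≤ c j ^ 2 * C) :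
    ∑ i, (∑ j ∈ s, f j i) ^ 2 ≤ (∑ j ∈ s, c j) ^ 2 * C := by
  have norm_le (j : κ) (hj : j ∈ s) : ‖WithLp.toLp 2 (f j)‖ ≤ c j * √C := by
    refine le_of_sq_le_sq ?_ (mul_nonneg (hc j hj) (Real.sqrt_nonneg C))
    rw [EuclideanSpace.real_norm_sq_eq, mul_pow, Real.sq_sqrt hC]
    exact hf j hj
  calc ∑ i, (∑ j ∈ s, f j i) ^ 2
      = ‖∑ j ∈ s, WithLp.toLp 2 (f j)‖ ^ 2 := by
        rw [← WithLp.toLp_sum, EuclideanSpace.real_norm_sq_eq]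
        simp only [Finset.sum_apply]
    _ ≤ (∑ j ∈ s, c j * √C) ^ 2 := by gcongr; exact norm_sum_le_of_le s norm_le
    _ = (∑ j ∈ s, c j) ^ 2 * C := by rw [← sum_mul, mul_pow, Real.sq_sqrt hC]

end SumSq

section MulVec

variable {α β : Type*} [Fintype α] [Fintype β] {M : Matrix α β ℝ}

theorem sum_mulVec_of_col_sum {c : ℝ} (hcol : ∀ y, ∑ x, M x y = c) (g : β → ℝ) :
    ∑ x, (M *ᵥ g) x = c * ∑ y, g y := by
  simp only [mulVec, dotProduct]
  rw [sum_comm]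
  simp only [← sum_mul, hcol, mul_sum]

theorem sum_sq_mulVec_le_of_nonneg {r c : ℝ} (hM : ∀ x y, 0 ≤ M x y) (hr : 0 ≤ r)
    (hrow : ∀ x, ∑ y, M x y ≤ r) (hcol : ∀ y, ∑ x, M x y ≤ c) (g : β → ℝ) :
    ∑ x, (M *ᵥ g) x ^ 2 ≤ r * c * ∑ y, g y ^ 2 := by
  have cauchy_schwarz (x : α) : (M *ᵥ g) x ^ 2 ≤ r * ∑ y, M x y * g y ^ 2 :=
    (sum_sq_le_sum_mul_sum_of_sq_le_mul univ (fun y _ => hM x y)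
      (fun y _ => mul_nonneg (hM x y) (sq_nonneg (g y))) fun y _ => le_of_eq (by ring)).trans <|
      mul_le_mul_of_nonneg_right (hrow x)
        (sum_nonneg fun y _ => mul_nonneg (hM x y) (sq_nonneg (g y)))
  calc ∑ x, (M *ᵥ g) x ^ 2
      ≤ ∑ x, r * ∑ y, M x y * g y ^ 2 := sum_le_sum fun x _ => cauchy_schwarz x
    _ = r * ∑ y, (∑ x, M x y) * g y ^ 2 := by
        rw [← mul_sum, sum_comm]
        simp only [sum_mul]
    _ ≤ r * ∑ y, c * g y ^ 2 := by gcongr with y; exact hcol y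
    _ = r * c * ∑ y, g y ^ 2 := by rw [← mul_sum, mul_assoc]

end MulVec

section PiKronecker

variable {α β : Type*} {k : ℕ}

/-- The Kronecker product of a family of matrices, indexed by tuples of row indices and tuples of
column indices. -/
def piKronecker (B : Fin k → Matrix α β ℝ) : Matrix (Fin k → α) (Fin k → β) ℝ :=
  of fun x y => ∏ i, B i (x i) (y i)

theorem piKronecker_succ (B : Fin (k + 1) → Matrix α β ℝ) :
    piKronecker B = (B 0 ⊗ₖ piKronecker (Fin.tail B)).submatrix
      (Fin.consEquiv fun _ => α).symm (Fin.consEquiv fun _ => β).symm := by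
  ext x y
  exact Fin.prod_univ_succ _

end PiKronecker

section Mixing

variable {α β α' β' : Type*} [Fintype α] [Fintype β] [Fintype α'] [Fintype β']

/-- The weighted form of an `r`-regular bipartite graph with relative spectral expansion `θ`: `M` is
nonnegative, its rows and columns have sum `r`, and it maps the functions of sum zero into
themselves with `ℓ²` operator norm at most `θ * r`. -/
structure IsMixing (M : Matrix α β ℝ) (r θ : ℝ) : Prop where
  nonneg : ∀ x y, 0 ≤ M x y
  row_sum : ∀ x, ∑ y, M x y = r
  col_sum : ∀ y, ∑ x, M x y = r
  sum_sq_mulVec_le : ∀ g : β → ℝ, ∑ y, g y = 0 →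
    ∑ x, (M *ᵥ g) x ^ 2 ≤ (θ * r) ^ 2 * ∑ y, g y ^ 2

namespace IsMixing

variable {M : Matrix α β ℝ} {N : Matrix α' β' ℝ} {r s θ : ℝ}

theorem degree_nonneg [Nonempty α] (hM : IsMixing M r θ) : 0 ≤ r :=
  hM.row_sum (Classical.arbitrary α) ▸ sum_nonneg fun y _ => hM.nonneg _ y

theorem card_mul_degree (hM : IsMixing M r θ) :
    Fintype.card α * r = Fintype.card β * r := by
  have double_count : ∑ x, ∑ y, M x y = ∑ y, ∑ x, M x y := sum_comm
  simpa only [hM.row_sum, hM.col_sum, sum_const, card_univ, nsmul_eq_mul] using double_count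

theorem mulVec_apply_eq_mulVec_balance_add (hM : IsMixing M r θ) (g : β → ℝ) (x : α) :
    (M *ᵥ g) x = (M *ᵥ Fintype.balance g) x + r * 𝔼 y, g y := by
  simp only [mulVec, dotProduct, Fintype.balance_apply, mul_sub, sum_sub_distrib, ← sum_mul,
    hM.row_sum, sub_add_cancel]

theorem sum_sq_mulVec_le_add (hM : IsMixing M r θ) (g : β → ℝ) :
    ∑ x, (M *ᵥ g) x ^ 2 ≤
      (θ * r) ^ 2 * ∑ y, Fintype.balance g y ^ 2 + r ^ 2 * (Fintype.card β * (𝔼 y, g y) ^ 2) := by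
  have sum_zero : ∑ x, (M *ᵥ Fintype.balance g) x = 0 := by
    rw [sum_mulVec_of_col_sum hM.col_sum, Fintype.sum_balance, mul_zero]
  simp only [hM.mulVec_apply_eq_mulVec_balance_add g, sum_sq_add_const sum_zero]
  refine add_le_add (hM.sum_sq_mulVec_le _ (Fintype.sum_balance g)) (le_of_eq ?_)
  linear_combination (r * (𝔼 y, g y) ^ 2) * hM.card_mul_degree

theorem sum_sq_mulVec_le_sq_degree (hM : IsMixing M r θ) (g : β → ℝ) :
    ∑ x, (M *ᵥ g) x ^ 2 ≤ r ^ 2 * ∑ y, g y ^ 2 := by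
  cases isEmpty_or_nonempty α
  · rw [univ_eq_empty, sum_empty]
    positivity
  · rw [sq r]
    exact sum_sq_mulVec_le_of_nonneg hM.nonneg hM.degree_nonneg (fun x => (hM.row_sum x).le)
      (fun y => (hM.col_sum y).le) g

theorem submatrix_equiv (hM : IsMixing M r θ) (e : α' ≃ α) (f : β' ≃ β) :
    IsMixing (M.submatrix e f) r θ where
  nonneg x y := hM.nonneg (e x) (f y)
  row_sum x := by simpa only [submatrix_apply, f.sum_comp (M (e x))] using hM.row_sum (e x)
  col_sum y := by
    simpa only [submatrix_apply, e.sum_comp fun x => M x (f y)] using hM.col_sum (f y)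
  sum_sq_mulVec_le g hg := by
    have h := hM.sum_sq_mulVec_le (g ∘ f.symm) ((f.symm.sum_comp g).trans hg)
    rw [submatrix_mulVec_equiv]
    simpa only [Function.comp_apply, e.sum_comp fun x => (M *ᵥ (g ∘ f.symm)) x ^ 2,
      f.symm.sum_comp fun y => g y ^ 2] using h

theorem one_sub (hM : IsMixing M r θ) (hle : ∀ x y, M x y ≤ 1)
    (hcard : Fintype.card α = Fintype.card β) (hr : r ≤ Fintype.card β - r) :
    IsMixing (of 1 - M) (Fintype.card β - r) θ where
  nonneg x y := sub_nonneg.2 (hle x y)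
  row_sum x := by simp [hM.row_sum]
  col_sum y := by simp [hM.col_sum, hcard]
  sum_sq_mulVec_le g hg := by
    have apply_eq_neg (x : α) : ((of 1 - M) *ᵥ g) x = -(M *ᵥ g) x := by
      simp [mulVec, dotProduct, sub_mul, hg]
    cases isEmpty_or_nonempty α
    · rw [univ_eq_empty, sum_empty]
      positivity
    · have := hM.degree_nonneg
      simp only [apply_eq_neg, neg_sq]
      refine (hM.sum_sq_mulVec_le g hg).trans ?_
      rw [mul_pow, mul_pow]
      gcongr

theorem sum {κ : Type*} {I : Finset κ} {M : κ → Matrix α β ℝ} {r : κ → ℝ} (hθ : 0 ≤ θ)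
    (hM : ∀ i ∈ I, IsMixing (M i) (r i) θ) : IsMixing (∑ i ∈ I, M i) (∑ i ∈ I, r i) θ where
  nonneg x y := by
    rw [Matrix.sum_apply]
    exact sum_nonneg fun i hi => (hM i hi).nonneg x y
  row_sum x := by
    simp only [Matrix.sum_apply]
    rw [sum_comm]
    exact sum_congr rfl fun i hi => (hM i hi).row_sum x
  col_sum y := by
    simp only [Matrix.sum_apply]
    rw [sum_comm]
    exact sum_congr rfl fun i hi => (hM i hi).col_sum y
  sum_sq_mulVec_le g hg := by
    cases isEmpty_or_nonempty α
    · rw [univ_eq_empty, sum_empty]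
      positivity
    · rw [mul_sum I, Matrix.sum_mulVec]
      simp only [Finset.sum_apply]
      exact sum_sq_sum_le I (by positivity) (fun i hi => mul_nonneg hθ (hM i hi).degree_nonneg)
        fun i hi => (hM i hi).sum_sq_mulVec_le g hg

theorem kronecker (hM : IsMixing M r θ) (hN : IsMixing N s θ) :
    IsMixing (M ⊗ₖ N) (r * s) θ where
  nonneg x y := mul_nonneg (hM.nonneg _ _) (hN.nonneg _ _)
  row_sum x := by
    simp only [kroneckerMap_apply, Fintype.sum_prod_type, ← mul_sum, ← sum_mul, hM.row_sum,
      hN.row_sum]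
  col_sum y := by
    simp only [kroneckerMap_apply, Fintype.sum_prod_type, ← mul_sum, ← sum_mul, hM.col_sum,
      hN.col_sum]
  sum_sq_mulVec_le g hg := by
    let mean : β' → ℝ := fun y' => 𝔼 y, g (y, y')
    let fluct : β → β' → ℝ := fun y y' => Fintype.balance (fun y => g (y, y')) y
    let slice : α' → β → ℝ := fun x' y => (N *ᵥ fun y' => g (y, y')) x'
    have sum_mean : ∑ y', mean y' = 0 := by
      rw [← expect_sum_comm, expect, ← Fintype.sum_prod_type, hg, smul_zero]
    have mulVec_apply (x : α) (x' : α') : ((M ⊗ₖ N) *ᵥ g) (x, x') = (M *ᵥ slice x') x := by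
      simp only [slice, mulVec, dotProduct, kroneckerMap_apply, Fintype.sum_prod_type, mul_sum,
        mul_assoc]
    have expect_slice (x' : α') : 𝔼 y, slice x' y = (N *ᵥ mean) x' := by
      simp only [slice, mean, mulVec, dotProduct, expect_sum_comm, mul_expect]
    have balance_slice (x' : α') (y : β) :
        Fintype.balance (slice x') y = (N *ᵥ fluct y) x' := by
      rw [Fintype.balance_apply, expect_slice]
      simp only [slice, fluct, mean, mulVec, dotProduct, Fintype.balance_apply, mul_sub,
        sum_sub_distrib]
    calc ∑ x, ((M ⊗ₖ N) *ᵥ g) x ^ 2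
        = ∑ x', ∑ x, (M *ᵥ slice x') x ^ 2 := by
          simp only [Fintype.sum_prod_type_right, mulVec_apply]
      _ ≤ ∑ x', ((θ * r) ^ 2 * ∑ y, (N *ᵥ fluct y) x' ^ 2
            + r ^ 2 * (Fintype.card β * (N *ᵥ mean) x' ^ 2)) :=
          sum_le_sum fun x' _ => by
            simpa only [balance_slice, expect_slice] using hM.sum_sq_mulVec_le_add (slice x')
      _ = (θ * r) ^ 2 * ∑ y, ∑ x', (N *ᵥ fluct y) x' ^ 2
            + r ^ 2 * (Fintype.card β * ∑ x', (N *ᵥ mean) x' ^ 2) := by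
          rw [sum_add_distrib, ← mul_sum, ← mul_sum, ← mul_sum, sum_comm]
      _ ≤ (θ * r) ^ 2 * ∑ y, s ^ 2 * ∑ y', fluct y y' ^ 2
            + r ^ 2 * (Fintype.card β * ((θ * s) ^ 2 * ∑ y', mean y' ^ 2)) := by
          gcongr with y
          · exact hN.sum_sq_mulVec_le_sq_degree (fluct y)
          · exact hN.sum_sq_mulVec_le mean sum_mean
      _ = (θ * (r * s)) ^ 2
            * ∑ y', (∑ y, fluct y y' ^ 2 + Fintype.card β * mean y' ^ 2) := by
          rw [sum_add_distrib, ← mul_sum, ← mul_sum, sum_comm]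
          ring
      _ = (θ * (r * s)) ^ 2 * ∑ y, g y ^ 2 := by
          simp only [fluct, mean, ← sum_sq_eq_sum_sq_balance_add, Fintype.sum_prod_type_right]

theorem abs_sum_sum_sub_le (hM : IsMixing M r θ) (hθ : 0 ≤ θ) (S : Finset α) (T : Finset β) :
    |∑ x ∈ S, ∑ y ∈ T, M x y - r * #S * #T / Fintype.card β| ≤ θ * r * √(#S * #T) := by
  classical
  rcases S.eq_empty_or_nonempty with rfl | hS
  · simp
  have : Nonempty α := hS.nonempty
  have hr := hM.degree_nonneg
  let ind : β → ℝ := fun y => if y ∈ T then 1 else 0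
  have sum_eq (x : α) :
      ∑ y ∈ T, M x y = (M *ᵥ Fintype.balance ind) x + r * (#T / Fintype.card β) := by
    have mulVec_ind : (M *ᵥ ind) x = ∑ y ∈ T, M x y := by simp [ind, mulVec, dotProduct]
    rw [← mulVec_ind, hM.mulVec_apply_eq_mulVec_balance_add, Fintype.expect_eq_sum_div_card]
    simp [ind]
  have sum_sq_le : ∑ y, Fintype.balance ind y ^ 2 ≤ #T := by
    have sum_sq_ind : ∑ y, ind y ^ 2 = #T := by simp [ind]
    rw [← sum_sq_ind, sum_sq_eq_sum_sq_balance_add ind]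
    exact le_add_of_nonneg_right (by positivity)
  calc |∑ x ∈ S, ∑ y ∈ T, M x y - r * #S * #T / Fintype.card β|
      = |∑ x ∈ S, (M *ᵥ Fintype.balance ind) x| := by
        simp only [sum_eq, sum_add_distrib, sum_const, nsmul_eq_mul]
        ring_nf
    _ ≤ θ * r * √(#S * #T) := by
        refine abs_le_of_sq_le_sq ?_ (by positivity)
        calc (∑ x ∈ S, (M *ᵥ Fintype.balance ind) x) ^ 2
            ≤ #S * ∑ x ∈ S, (M *ᵥ Fintype.balance ind) x ^ 2 := sq_sum_le_card_mul_sum_sq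
          _ ≤ #S * ∑ x, (M *ᵥ Fintype.balance ind) x ^ 2 := by
              gcongr
              exact subset_univ S
          _ ≤ #S * ((θ * r) ^ 2 * #T) := by
              gcongr
              refine (hM.sum_sq_mulVec_le _ (Fintype.sum_balance ind)).trans ?_
              gcongr
          _ = (θ * r * √(#S * #T)) ^ 2 := by
              rw [mul_pow (θ * r), Real.sq_sqrt (by positivity)]
              ring

end IsMixing

theorem isMixing_piKronecker_zero (B : Fin 0 → Matrix α β ℝ) (θ : ℝ) :
    IsMixing (piKronecker B) 1 θ where
  nonneg x y := by simp [piKronecker]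
  row_sum x := by simp [piKronecker]
  col_sum y := by simp [piKronecker]
  sum_sq_mulVec_le g hg := by
    rw [Fintype.sum_unique] at hg
    simp [mulVec, dotProduct, hg]

theorem IsMixing.piKronecker {k : ℕ} {B : Fin k → Matrix α β ℝ} {r : Fin k → ℝ} {θ : ℝ}
    (hB : ∀ i, IsMixing (B i) (r i) θ) : IsMixing (piKronecker B) (∏ i, r i) θ := by
  induction k with
  | zero => simpa using isMixing_piKronecker_zero B θ
  | succ k ih =>
    rw [piKronecker_succ, Fin.prod_univ_succ]
    exact ((hB 0).kronecker (ih fun i => hB i.succ)).submatrix_equiv _ _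

end Mixing

section Rayleigh

variable {E : Type*} [NormedAddCommGroup E] [InnerProductSpace ℝ E] [FiniteDimensional ℝ E]
  {n : ℕ} {T : E →ₗ[ℝ] E}

theorem inner_apply_self_eq_sum_eigenvalues_mul_sq (hT : T.IsSymmetric)
    (hn : Module.finrank ℝ E = n) (v : E) :
    ⟪T v, v⟫_ℝ = ∑ i, hT.eigenvalues hn i * ⟪hT.eigenvectorBasis hn i, v⟫_ℝ ^ 2 := by
  rw [← (hT.eigenvectorBasis hn).sum_inner_mul_inner]
  refine sum_congr rfl fun i _ => ?_
  rw [hT v, hT.apply_eigenvectorBasis, RCLike.ofReal_real_eq_id, id, real_inner_smul_right,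
    real_inner_comm v]
  ring

theorem inner_apply_self_le_eigenvalue_mul_sq_norm (hT : T.IsSymmetric)
    (hn : Module.finrank ℝ E = n) (i : Fin n) {v : E}
    (hv : ∀ j < i, ⟪hT.eigenvectorBasis hn j, v⟫_ℝ = 0) :
    ⟪T v, v⟫_ℝ ≤ hT.eigenvalues hn i * ‖v‖ ^ 2 := by
  rw [inner_apply_self_eq_sum_eigenvalues_mul_sq hT hn,
    ← (hT.eigenvectorBasis hn).sum_sq_inner_right, mul_sum]
  refine sum_le_sum fun j _ => ?_
  rcases lt_or_ge j i with hji | hij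
  · simp only [hv j hji, ne_eq, OfNat.ofNat_ne_zero, not_false_eq_true, zero_pow, mul_zero, le_refl]
  · exact mul_le_mul_of_nonneg_right (hT.eigenvalues_antitone hn hij) (sq_nonneg _)

theorem inner_apply_self_le_second_eigenvalue_mul_sq_norm (hT : T.IsSymmetric)
    (hn : Module.finrank ℝ E = n) (h1 : 1 < n) {u v : E} {μ : ℝ} (hu : T u = μ • u) (hu0 : u ≠ 0)
    (huv : ⟪u, v⟫_ℝ = 0) (hv : ⟪T v, v⟫_ℝ ≤ μ * ‖v‖ ^ 2) :
    ⟪T v, v⟫_ℝ ≤ hT.eigenvalues hn ⟨1, h1⟩ * ‖v‖ ^ 2 := by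
  let b := hT.eigenvectorBasis hn ⟨0, by lia⟩
  have le_of_orthogonal {w : E} (hw : ⟪b, w⟫_ℝ = 0) :
      ⟪T w, w⟫_ℝ ≤ hT.eigenvalues hn ⟨1, h1⟩ * ‖w‖ ^ 2 :=
    inner_apply_self_le_eigenvalue_mul_sq_norm hT hn ⟨1, h1⟩ fun j hj => by
      obtain rfl : j = ⟨0, by lia⟩ := Fin.ext (by simpa [Fin.lt_def] using hj)
      exact hw
  by_contra! hlt
  have inner_b_ne_zero : ⟪b, v⟫_ℝ ≠ 0 := fun h => hlt.not_ge (le_of_orthogonal h)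
  have eigenvalue_lt : hT.eigenvalues hn ⟨1, h1⟩ < μ :=
    lt_of_mul_lt_mul_right (hlt.trans_le hv) (sq_nonneg ‖v‖)
  -- The span of `u` and `v` contains a nonzero vector orthogonal to the top eigenvector `b`.
  let w := ⟪b, v⟫_ℝ • u - ⟪b, u⟫_ℝ • v
  have inner_b_w : ⟪b, w⟫_ℝ = 0 := by
    simp only [w, inner_sub_right, real_inner_smul_right]
    ring
  have norm_sq_w : ‖w‖ ^ 2 = ⟪b, v⟫_ℝ ^ 2 * ‖u‖ ^ 2 + ⟪b, u⟫_ℝ ^ 2 * ‖v‖ ^ 2 := by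
    simp only [w, norm_sub_sq_real, real_inner_smul_left, real_inner_smul_right, huv, norm_smul,
      mul_pow, Real.norm_eq_abs, sq_abs]
    ring
  have inner_T_w : ⟪T w, w⟫_ℝ = ⟪b, v⟫_ℝ ^ 2 * (μ * ‖u‖ ^ 2) + ⟪b, u⟫_ℝ ^ 2 * ⟪T v, v⟫_ℝ := by
    have inner_T_v_u : ⟪T v, u⟫_ℝ = 0 := by
      rw [hT v, hu, real_inner_smul_right, real_inner_comm, huv, mul_zero]
    simp only [w, map_sub, map_smul, inner_sub_left, inner_sub_right, real_inner_smul_left,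
      real_inner_smul_right, hu, huv, inner_T_v_u, real_inner_self_eq_norm_sq]
    ring
  have u_part_pos : 0 < ⟪b, v⟫_ℝ ^ 2 * ((μ - hT.eigenvalues hn ⟨1, h1⟩) * ‖u‖ ^ 2) :=
    mul_pos (sq_pos_of_ne_zero inner_b_ne_zero)
      (mul_pos (sub_pos.2 eigenvalue_lt) (pow_pos (norm_pos_iff.2 hu0) 2))
  have v_part_nonneg := mul_nonneg (sq_nonneg ⟪b, u⟫_ℝ) (sub_pos.2 hlt).le
  have rayleigh_w := le_of_orthogonal inner_b_w
  rw [inner_T_w, norm_sq_w] at rayleigh_w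
  linarith

end Rayleigh

section SecondEigenvalue

variable {V : Type*} [Fintype V] {G : SimpleGraph V} [DecidableRel G.Adj] {d : ℕ}

theorem dotProduct_adjMatrix_mulVec_le_degree (hG : G.IsRegularOfDegree d) (f : V → ℝ) :
    f ⬝ᵥ G.adjMatrix ℝ *ᵥ f ≤ d * ∑ v, f v ^ 2 := by
  classical
  have lap_nonneg : 0 ≤ f ⬝ᵥ G.lapMatrix ℝ *ᵥ f := by
    simpa only [star_trivial] using (G.posSemidef_lapMatrix ℝ).dotProduct_mulVec_nonneg f
  rw [SimpleGraph.lapMatrix, sub_mulVec, dotProduct_sub,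
    SimpleGraph.dotProduct_mulVec_degMatrix] at lap_nonneg
  simpa only [hG.degree_eq, mul_sum, mul_assoc, ← sq, sub_nonneg] using lap_nonneg

variable [DecidableEq V]

theorem bipartiteLambda_nonneg (G : SimpleGraph V) [DecidableRel G.Adj] : 0 ≤ bipartiteLambda G :=
  le_max_of_le_right (abs_nonneg _)

theorem dotProduct_adjMatrix_mulVec_le_eigenvalue_one (hG : G.IsRegularOfDegree d) {f : V → ℝ}
    (hf : ∑ v, f v = 0) : f ⬝ᵥ G.adjMatrix ℝ *ᵥ f ≤ eigenvalue G 1 * ∑ v, f v ^ 2 := by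
  rcases subsingleton_or_nontrivial V with _ | _
  · have f_eq_zero : f = 0 := funext fun v => by simpa [Fintype.sum_subsingleton f v] using hf
    simp [f_eq_zero]
  have one_lt_card := Fintype.one_lt_card (α := V)
  rw [eigenvalue, dif_pos one_lt_card]
  have inner_eq : ⟪(G.adjMatrix ℝ).toEuclideanLin (WithLp.toLp 2 f), WithLp.toLp 2 f⟫_ℝ =
      f ⬝ᵥ G.adjMatrix ℝ *ᵥ f := by
    simp [toEuclideanLin, EuclideanSpace.inner_eq_star_dotProduct]
  have const_eigenvector : (G.adjMatrix ℝ).toEuclideanLin (WithLp.toLp 2 1) =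
      (d : ℝ) • WithLp.toLp 2 (1 : V → ℝ) := by
    ext v
    simpa [toEuclideanLin] using
      SimpleGraph.adjMatrix_mulVec_const_apply_of_regular (α := ℝ) (a := 1) hG (v := v)
  have inner_const : ⟪WithLp.toLp 2 1, WithLp.toLp 2 f⟫_ℝ = 0 := by
    simpa [EuclideanSpace.inner_eq_star_dotProduct, dotProduct_one] using hf
  have le_degree := dotProduct_adjMatrix_mulVec_le_degree hG f
  rw [← inner_eq, ← EuclideanSpace.real_norm_sq_eq (WithLp.toLp 2 f)] at le_degree ⊢
  exact inner_apply_self_le_second_eigenvalue_mul_sq_norm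
    (isSymmetric_toEuclideanLin_iff.mpr (G.isHermitian_adjMatrix ℝ)) finrank_euclideanSpace
    one_lt_card const_eigenvector (by simp) inner_const le_degree

end SecondEigenvalue

section Bipartite

variable {X Y : Type*} {G : SimpleGraph (X ⊕ Y)}

theorem not_adj_inl_inl (hG : G ≤ completeBipartiteGraph X Y) (x x' : X) :
    ¬G.Adj (.inl x) (.inl x') := fun h => by simpa using hG h

theorem not_adj_inr_inr (hG : G ≤ completeBipartiteGraph X Y) (y y' : Y) :
    ¬G.Adj (.inr y) (.inr y') := fun h => by simpa using hG h

/-- The biadjacency matrix of a bipartite graph with parts `X` and `Y`: the `X × Y` block of its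
adjacency matrix. -/
def biadjMatrix (G : SimpleGraph (X ⊕ Y)) [DecidableRel G.Adj] : Matrix X Y ℝ :=
  (G.adjMatrix ℝ).toBlocks₁₂

variable [DecidableRel G.Adj]

theorem biadjMatrix_apply (x : X) (y : Y) :
    biadjMatrix G x y = if G.Adj (.inl x) (.inr y) then 1 else 0 := rfl

theorem biadjMatrix_nonneg (x : X) (y : Y) : 0 ≤ biadjMatrix G x y := by
  rw [biadjMatrix_apply]
  positivity

theorem biadjMatrix_le_one (x : X) (y : Y) : biadjMatrix G x y ≤ 1 := by
  rw [biadjMatrix_apply]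
  split_ifs <;> norm_num

theorem adjMatrix_eq_fromBlocks (hG : G ≤ completeBipartiteGraph X Y) :
    G.adjMatrix ℝ = fromBlocks 0 (biadjMatrix G) (biadjMatrix G)ᵀ 0 := by
  ext (x | y) (x' | y') <;>
    simp [not_adj_inl_inl hG, not_adj_inr_inr hG, biadjMatrix_apply, G.adj_comm]

theorem edgeCount_map_inl_map_inr (S : Finset X) (T : Finset Y) :
    (edgeCount G (S.map .inl) (T.map .inr) : ℝ) = ∑ x ∈ S, ∑ y ∈ T, biadjMatrix G x y := by
  simp only [edgeCount, SimpleGraph.interedges_def, card_filter, sum_product, sum_map,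
    Nat.cast_sum, Nat.cast_ite, Nat.cast_one, Nat.cast_zero]
  rfl

variable [Fintype X] [Fintype Y]

theorem sum_biadjMatrix_row (hG : G ≤ completeBipartiteGraph X Y) (x : X) :
    ∑ y, biadjMatrix G x y = G.degree (.inl x) := by
  rw [G.degree_eq_sum_if_adj, Fintype.sum_sum_type]
  simp only [not_adj_inl_inl hG, biadjMatrix_apply, if_false, sum_const_zero, zero_add]

theorem sum_biadjMatrix_col (hG : G ≤ completeBipartiteGraph X Y) (y : Y) :
    ∑ x, biadjMatrix G x y = G.degree (.inr y) := by
  rw [G.degree_eq_sum_if_adj, Fintype.sum_sum_type]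
  simp only [not_adj_inr_inr hG, biadjMatrix_apply, if_false, sum_const_zero, add_zero,
    G.adj_comm (.inr y)]

theorem IsMixing.degree_eq {r θ : ℝ} (hG : G ≤ completeBipartiteGraph X Y)
    (hmix : IsMixing (biadjMatrix G) r θ) : ∀ v, (G.degree v : ℝ) = r
  | .inl x => (sum_biadjMatrix_row hG x).symm.trans (hmix.row_sum x)
  | .inr y => (sum_biadjMatrix_col hG y).symm.trans (hmix.col_sum y)

theorem IsMixing.mu_eq {M : Matrix X Y ℝ} {r θ : ℝ} (hM : IsMixing M r θ) (S : Finset X)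
    (T : Finset Y) : mu (X ⊕ Y) r (S.map .inl) (T.map .inr) = r * #S * #T / Fintype.card Y := by
  rcases eq_or_ne r 0 with rfl | hr
  · simp [mu]
  · have hcard := mul_right_cancel₀ hr hM.card_mul_degree
    simp [mu, hcard]

theorem IsMixing.abs_edgeCount_sub_mu_le {r θ : ℝ} (hmix : IsMixing (biadjMatrix G) r θ)
    (hθ : 0 ≤ θ) (S : Finset X) (T : Finset Y) :
    |(edgeCount G (S.map .inl) (T.map .inr) : ℝ) - mu (X ⊕ Y) r (S.map .inl) (T.map .inr)|
      ≤ θ * r * √(#S * #T) := by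
  rw [edgeCount_map_inl_map_inr, hmix.mu_eq]
  exact hmix.abs_sum_sum_sub_le hθ S T

theorem sumElim_dotProduct_adjMatrix_mulVec (hG : G ≤ completeBipartiteGraph X Y) (f : X → ℝ)
    (g : Y → ℝ) :
    Sum.elim f g ⬝ᵥ G.adjMatrix ℝ *ᵥ Sum.elim f g = 2 * (f ⬝ᵥ biadjMatrix G *ᵥ g) := by
  have transpose_form : g ⬝ᵥ (biadjMatrix G)ᵀ *ᵥ f = f ⬝ᵥ biadjMatrix G *ᵥ g := by
    rw [mulVec_transpose, dotProduct_comm, dotProduct_mulVec]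
  rw [adjMatrix_eq_fromBlocks hG, fromBlocks_mulVec, sumElim_dotProduct_sumElim]
  simp only [Sum.elim_comp_inl, Sum.elim_comp_inr, zero_mulVec, zero_add, add_zero, transpose_form,
    two_mul]

variable [DecidableEq X] [DecidableEq Y] {d : ℕ}

theorem sum_sq_biadjMatrix_mulVec_le (hG : G ≤ completeBipartiteGraph X Y)
    (hreg : G.IsRegularOfDegree d) {g : Y → ℝ} (hg : ∑ y, g y = 0) :
    ∑ x, (biadjMatrix G *ᵥ g) x ^ 2 ≤ bipartiteLambda G ^ 2 * ∑ y, g y ^ 2 := by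
  let f := biadjMatrix G *ᵥ g
  have sum_f : ∑ x, f x = 0 := by
    rw [sum_mulVec_of_col_sum (fun y => (sum_biadjMatrix_col hG y).trans (by rw [hreg.degree_eq])),
      hg, mul_zero]
  have form_f_g : f ⬝ᵥ biadjMatrix G *ᵥ g = ∑ x, f x ^ 2 := by simp only [f, dotProduct, sq]
  have eigenvalue_le : eigenvalue G 1 ≤ bipartiteLambda G := le_max_left _ _
  -- The Rayleigh bound for the test function `(f, a • g)`; its discriminant gives the claim.
  have quadratic_nonneg (a : ℝ) : 0 ≤ (bipartiteLambda G * ∑ y, g y ^ 2) * (a * a) +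
      (-2 * ∑ x, f x ^ 2) * a + bipartiteLambda G * ∑ x, f x ^ 2 := by
    have sum_test : ∑ v, Sum.elim f (a • g) v = 0 := by
      simp [Fintype.sum_sum_type, sum_f, ← mul_sum, hg]
    have rayleigh := (dotProduct_adjMatrix_mulVec_le_eigenvalue_one hreg sum_test).trans <|
      mul_le_mul_of_nonneg_right eigenvalue_le (sum_nonneg fun v _ => sq_nonneg _)
    rw [sumElim_dotProduct_adjMatrix_mulVec hG, mulVec_smul, dotProduct_smul, form_f_g]
      at rayleigh
    simp only [Fintype.sum_sum_type, Sum.elim_inl, Sum.elim_inr, Pi.smul_apply, smul_eq_mul,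
      mul_pow, ← mul_sum] at rayleigh
    linarith
  have discrim_le := discrim_le_zero quadratic_nonneg
  rw [discrim] at discrim_le
  rcases (sum_nonneg fun x _ => sq_nonneg (f x)).eq_or_lt' with sum_sq_f | sum_sq_f
  · exact sum_sq_f.trans_le (by positivity)
  · exact le_of_mul_le_mul_right (by linarith) sum_sq_f

theorem isMixing_biadjMatrix (hG : G ≤ completeBipartiteGraph X Y) (hd : d ≠ 0)
    (hreg : G.IsRegularOfDegree d) : IsMixing (biadjMatrix G) d (bipartiteLambda G / d) where
  nonneg := biadjMatrix_nonneg
  row_sum x := by rw [sum_biadjMatrix_row hG, hreg.degree_eq]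
  col_sum y := by rw [sum_biadjMatrix_col hG, hreg.degree_eq]
  sum_sq_mulVec_le g hg := by
    rw [div_mul_cancel₀ _ (Nat.cast_ne_zero.2 hd)]
    exact sum_sq_biadjMatrix_mulVec_le hG hreg hg

end Bipartite

section BGP

theorem sum_le_card_prod_ite {R : Type*} [CommSemiring R] (a b : R) (k t : ℕ) :
    ∑ I : Finset (Fin k) with t ≤ #I, ∏ i, (if i ∈ I then a else b) =
      ∑ m ∈ Icc t k, k.choose m * a ^ m * b ^ (k - m) := by
  have prod_eq (I : Finset (Fin k)) :
      ∏ i, (if i ∈ I then a else b) = a ^ #I * b ^ (k - #I) := by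
    rw [prod_ite, prod_const, prod_const, filter_univ_mem, filter_not, filter_univ_mem,
      ← compl_eq_univ_sdiff, card_compl, Fintype.card_fin]
  have Icc_eq : Icc t k = {m ∈ range (k + 1) | t ≤ m} := by
    ext m
    simp only [mem_Icc, mem_filter, mem_range]
    lia
  have group_by_card := sum_powerset_apply_card (x := (univ : Finset (Fin k)))
    fun m => if t ≤ m then a ^ m * b ^ (k - m) else 0
  simp only [powerset_univ, card_univ, Fintype.card_fin, nsmul_eq_mul, mul_ite, mul_zero,
    ← sum_filter, ← mul_assoc] at group_by_card
  simp only [prod_eq, group_by_card, Icc_eq]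

variable {X Y : Type*} {G : SimpleGraph (X ⊕ Y)} [DecidableRel G.Adj]

theorem bgp_le_completeBipartiteGraph (G : SimpleGraph (X ⊕ Y)) [DecidableRel G.Adj] (k t : ℕ) :
    bgp G k t ≤ completeBipartiteGraph (Fin k → X) (Fin k → Y) := by
  rintro (x | y) (x' | y') h
  · exact h.elim
  · simp
  · simp
  · exact h.elim

theorem biadjMatrix_bgp (k t : ℕ) :
    biadjMatrix (bgp G k t) = ∑ I : Finset (Fin k) with t ≤ #I,
      piKronecker fun i => if i ∈ I then biadjMatrix G else of 1 - biadjMatrix G := by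
  ext x y
  let edges : Finset (Fin k) := {i | G.Adj (.inl (x i)) (.inr (y i))}
  have prod_eq (I : Finset (Fin k)) :
      ∏ i, (if i ∈ I then biadjMatrix G else of 1 - biadjMatrix G) (x i) (y i) =
        if I = edges then 1 else 0 := by
    have factor_eq (i : Fin k) : (if i ∈ I then biadjMatrix G else of 1 - biadjMatrix G) (x i) (y i)
        = if (i ∈ I ↔ i ∈ edges) then 1 else 0 := by
      simp only [edges, mem_filter_univ]
      split_ifs <;> simp_all [biadjMatrix_apply]
    simp only [factor_eq, prod_boole, mem_univ, true_imp_iff, Finset.ext_iff]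
  rw [Matrix.sum_apply]
  simp only [piKronecker, of_apply, prod_eq, sum_ite_eq', mem_filter_univ]
  rw [biadjMatrix_apply]
  exact if_congr Iff.rfl rfl rfl

variable [Fintype X] [Fintype Y]

theorem isMixing_biadjMatrix_bgp {n d : ℕ} {θ : ℝ} (hθ : 0 ≤ θ)
    (hmix : IsMixing (biadjMatrix G) d θ) (hX : (Fintype.card X : ℝ) = n / 2)
    (hY : (Fintype.card Y : ℝ) = n / 2) (hdn : (d : ℝ) ≤ n / 4) (k t : ℕ) :
    IsMixing (biadjMatrix (bgp G k t)) (d₂ n d k t) θ := by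
  have hcompl : IsMixing (of 1 - biadjMatrix G) (n / 2 - d) θ := by
    rw [← hY]
    exact hmix.one_sub biadjMatrix_le_one (Nat.cast_injective (hX.trans hY.symm)) (by linarith)
  rw [biadjMatrix_bgp, d₂, ← sum_le_card_prod_ite]
  refine .sum hθ fun I _ => .piKronecker fun i => ?_
  split_ifs
  · exact hmix
  · exact hcompl

end BGP

end BipartiteProduct

theorem mainTheorem6 {X Y : Type*} [Fintype X] [Fintype Y] [DecidableEq X] [DecidableEq Y]
    (G : SimpleGraph (X ⊕ Y)) [DecidableRel G.Adj]
    (hbip : G ≤ completeBipartiteGraph X Y)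
    (n d k t : ℕ) (hn : Fintype.card (X ⊕ Y) = n) (hd : 0 < d)
    (hreg : G.IsRegularOfDegree d) (hdn : (d : ℝ) ≤ (n : ℝ) / 4) :
    (∀ v, ((BipartiteProduct.bgp G k t).degree v : ℝ) = BipartiteProduct.d₂ n d k t) ∧
    ∀ (S : Finset (Fin k → X)) (T : Finset (Fin k → Y)),
      |(BipartiteProduct.edgeCount (BipartiteProduct.bgp G k t)
            (S.map Function.Embedding.inl) (T.map Function.Embedding.inr) : ℝ)
          - BipartiteProduct.mu ((Fin k → X) ⊕ (Fin k → Y)) (BipartiteProduct.d₂ n d k t)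
            (S.map Function.Embedding.inl) (T.map Function.Embedding.inr)|
        ≤ BipartiteProduct.bipartiteLambda G / (d : ℝ) * BipartiteProduct.d₂ n d k t
            * √((S.card : ℝ) * (T.card : ℝ)) := by
  have hmix := BipartiteProduct.isMixing_biadjMatrix hbip hd.ne' hreg
  have hθ : 0 ≤ BipartiteProduct.bipartiteLambda G / (d : ℝ) :=
    div_nonneg (BipartiteProduct.bipartiteLambda_nonneg G) d.cast_nonneg
  have hcard : (Fintype.card X : ℝ) = Fintype.card Y :=
    mul_right_cancel₀ (Nat.cast_ne_zero.2 hd.ne') hmix.card_mul_degree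
  have hsum : (Fintype.card X : ℝ) + Fintype.card Y = n := by
    rw [← hn, Fintype.card_sum, Nat.cast_add]
  have hbgp := BipartiteProduct.isMixing_biadjMatrix_bgp hθ hmix (by linarith) (by linarith) hdn k t
  exact ⟨hbgp.degree_eq (BipartiteProduct.bgp_le_completeBipartiteGraph G k t),
    hbgp.abs_edgeCount_sub_mu_le hθ⟩
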